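/- **Setting.** Let $M$ be a compact metric space with metric $\rho$ on which a group $G$ acts by isometries and 2-point-homogeneously: whenever $\rho(x,y)=\rho(x',y')$ there is $g\in G$ with $gx=x'$, $gy=y'$. Let $\mu$ be a $G$-invariant Borel probability measure on $M$, let $\tau(x,y)=F(\rho(x,y))$ for a function $F:\mathbb R\to\mathbb R$, put $\tau_0=F(0)=\tau(x,x)$ and $T=\{\tau(x,y):x,y\in M\}$. Let $D\in\mathbb N\cup\{\infty\}$ and let $\Phi=(\Phi_k)_{0\le k\le D}$ be the zonal spherical functions of $M$, assumed to be polynomials of degree $k$. That is, $L^2(M,\mu)$ is the closure of the sum of pairwise orthogonal, finite-dimensional, irreducible $G$-stable spaces $V_k$ ($0\le k\le D$) of continuous complex functions; $\Phi_k(\tau(x,y))$ is a real multiple of $\sum_i\varphi_i(x)\overline{\varphi_i(y)}$, where $(\varphi_i)$ is an orthonormal basis of $V_k$; $\Phi_k(t)=\sum_{d=0}^k p_{kd}t^d$ is a real polynomial of degree $k$; and $\Phi_k(\tau_0)=1$. ($D$ is finite when $M$ is finite.) Let $S=T\cap[a,b]$. An $S$-code is a finite set $C\subset M$ with $\tau(x,y)\in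 S$ for all distinct $x,y\in C$. For $\Pi\subseteq M$ let $A(\Pi,S)$ be the largest size of an $S$-code contained in $\Pi$ ($+\infty$ if these sizes are unbounded). Let $q_1,\dots,q_r\in M$, $-\infty\le\alpha_i\le\beta_i\le\infty$, and $$\Pi_1=\{x\in M:\ \alpha_i\le\tau(x,q_i)\le\beta_i,\ i=1,\dots,r\}.$$ Let $\ell\ge1$ and $a=u_1<u_2<\dots<u_{\ell+1}=b$. For a code $C$ let $x_i^{(k)}(C)$ be the sum of $\tau(x,y)^k$ over the ordered pairs of distinct points $x,y\in C$ with $\tau(x,y)\in[u_i,u_{i+1})$ (with $\tau(x,y)\in[u_\ell,b]$ if $i=\ell$). Let $Ad$ be a (possibly empty) set of linear matrix inequalities with real symmetric matrices, each involving $c$ and finitely many of the variables $x_i^{(k)}$ ($1\le i\le\ell$, $k\ge0$), such that for every $S$-code $C\subseteq\Pi$ all of them hold at $c=|C|$, $x_i^{(k)}=x_i^{(k)}(C)$. For real $s_0,\dots,s_{2m-1}$ let $H_m(s_0,\dots,s_{2m-1},[\alpha,\beta])$ be the block diagonal matrix with the three $m\times m$ blocks $(s_{i+j})$, $(s_{i+j+1}-\alpha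 s_{i+j})$, $(\beta s_{i+j}-s_{i+j+1})$, $0\le i,j<m$; a block with an infinite endpoint is omitted. **The program.** For $m\ge1$ let $c^*(m)\in[-\infty,\infty]$ be the supremum of $c$ over all real $c$, $x_i^{(k)}$ $(1\le i\le\ell)$ and $y_i^{(k)}$ $(1\le i\le r)$, $0\le k\le 2m-1$ (together with any further $x_i^{(k)}$ that occur in $Ad$), subject to * (7) $H_m(x_i^{(0)},\dots,x_i^{(2m-1)},[u_i,u_{i+1}])\succeq0$ for $1\le i\le\ell$; * (8) all the constraints in $Ad$; * (9) $G_k\succeq0$ for $0\le k\le\min(2m-1,D)$, where $G_k$ is the symmetric $(r+1)\times(r+1)$ matrix with entries $(G_k)_{ij}=\Phi_k(\tau(q_i,q_j))$ for $i,j\le r$, $(G_k)_{i,r+1}=\sum_{d=0}^k p_{kd}\,y_i^{(d)}$ for $i\le r$, and $(G_k)_{r+1,r+1}=c+\sum_{d=0}^k p_{kd}\sum_{i=1}^{\ell}x_i^{(d)}$; moreover $y_i^{(0)}=c$ for $1\le i\le r$; * (10) $H_m(y_i^{(0)},\dots,y_i^{(2m-1)},[\alpha_i,\beta_i])\succeq0$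 for $1\le i\le r$. Let $SDPA(\Pi_1,\Phi,[a,b],Ad)=\inf_{m\ge1}c^*(m)$. **Theorem.** If $\Pi\subseteq\Pi_1$, then for every $m\ge1$ $$A(\Pi,S)\ \le\ SDPA(\Pi_1,\Phi,[a,b],Ad)\ \le\ c^*(m).$$ -/

import Mathlib

open MeasureTheory Polynomial

noncomputable section

namespace SDPCodes

/-! ### Two-point-homogeneous spaces and zonal spherical functions -/

/-- A group `G` acting by isometries on a metric space `M` acts two-point-homogeneously: any two
pairs of points at the same distance are related by an element of `G`. -/
def IsTwoPointHomogeneous (G M : Type*) [MetricSpace M] [Group G] [MulAction G M]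
    [IsIsometricSMul G M] : Prop :=
  ∀ x y x' y' : M, dist x y = dist x' y' → ∃ g : G, g • x = x' ∧ g • y = y'

section Zonal

variable {M : Type*} [MetricSpace M] (G : Type*) [Group G] [MulAction G M] [IsIsometricSMul G M]

/-- A space of continuous functions on `M` is stable under the translations
`f ↦ (x ↦ f (g⁻¹ • x))`. -/
def IsInvariantSpace (V : Submodule ℂ C(M, ℂ)) : Prop :=
  ∀ g : G, ∀ f ∈ V, ∃ f' ∈ V, ∀ x, f' x = f (g⁻¹ • x)

/-- An irreducible `G`-stable space of continuous functions. -/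
def IsIrreducibleSpace (V : Submodule ℂ C(M, ℂ)) : Prop :=
  V ≠ ⊥ ∧ IsInvariantSpace G V ∧ ∀ W ≤ V, IsInvariantSpace G W → W = ⊥ ∨ W = V

/-- `Φ` is, up to a real factor, the zonal spherical function of the finite-dimensional space `V`:
`Φ (τ(x,y))` is proportional to `∑ i, φ i x * conj (φ i y)`, where `φ` is an orthonormal basis of
`V` for the inner product of `L²(μ)`. -/
def IsZonalOf [MeasurableSpace M] (μ : Measure M) (τ : M → M → ℝ) (V : Submodule ℂ C(M, ℂ))
    (Φ : ℝ[X]) : Prop :=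
  ∃ (n : ℕ) (φ : Fin n → C(M, ℂ)) (κ : ℝ),
    Submodule.span ℂ (Set.range φ) = V ∧
    (∀ i j, ∫ x, φ i x * (starRingEnd ℂ) (φ j x) ∂μ = if i = j then 1 else 0) ∧
    ∀ x y, (((Φ.eval (τ x y) : ℝ)) : ℂ) = κ * ∑ i, φ i x * (starRingEnd ℂ) (φ i y)

/-- The polynomials `Φ k`, `0 ≤ k ≤ D`, are the zonal spherical functions of `M` with respect to
`τ(x,y) = F (dist x y)`: `L²(μ)` is the closure of the sum of pairwise orthogonal irreducible
`G`-stable finite-dimensional spaces `V k`, `0 ≤ k ≤ D`, the function `Φ k` is the zonal spherical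
function of `V k`, it is a polynomial of degree `k`, and `Φ k (τ₀) = 1` with `τ₀ = τ(x,x) = F 0`.
Here `D = ⊤` if there are infinitely many spaces, while `D` is finite for a finite space `M`. -/
def IsZonalFamily [CompactSpace M] [MeasurableSpace M] [BorelSpace M]
    (μ : Measure M) [IsFiniteMeasure μ] (F : ℝ → ℝ) (D : ℕ∞) (Φ : ℕ → ℝ[X]) : Prop :=
  ∃ V : ℕ → Submodule ℂ C(M, ℂ),
    (∀ k : ℕ, (k : ℕ∞) ≤ D → IsIrreducibleSpace G (V k)) ∧
    (∀ j k : ℕ, (j : ℕ∞) ≤ D → (k : ℕ∞) ≤ D → j ≠ k →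
      ∀ f ∈ V j, ∀ h ∈ V k, ∫ x, f x * (starRingEnd ℂ) (h x) ∂μ = 0) ∧
    (⨆ (k : ℕ) (_ : (k : ℕ∞) ≤ D),
      (V k).map (ContinuousMap.toLp 2 μ ℂ).toLinearMap).topologicalClosure = ⊤ ∧
    ∀ k : ℕ, (k : ℕ∞) ≤ D →
      IsZonalOf μ (fun x y => F (dist x y)) (V k) (Φ k) ∧
      (Φ k).degree = (k : WithBot ℕ) ∧ (Φ k).eval (F 0) = 1

end Zonal

/-! ### Codes -/

section Codes

variable {M : Type*} (τ : M → M → ℝ)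

/-- `S = T ∩ [a,b]`, where `T` is the set of all values of `τ`. -/
def valueSet (a b : ℝ) : Set ℝ := {t | ∃ x y : M, τ x y = t} ∩ Set.Icc a b

/-- `C` is an `S`-code. -/
def IsCode (S : Set ℝ) (C : Finset M) : Prop :=
  ∀ x ∈ C, ∀ y ∈ C, x ≠ y → τ x y ∈ S

/-- The largest size of an `S`-code contained in `P` (it is `⊤` if the sizes are unbounded). -/
def maxCodeSize (P : Set M) (S : Set ℝ) : EReal :=
  ⨆ (C : Finset M) (_ : (C : Set M) ⊆ P ∧ IsCode τ S C), ((C.card : ℝ) : EReal)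

/-- The region of all `x` with `α i ≤ τ(x, q i) ≤ β i` for all `i`; the bounds may be infinite. -/
def region {r : ℕ} (q : Fin r → M) (α β : Fin r → EReal) : Set M :=
  {x | ∀ i, α i ≤ (τ x (q i) : EReal) ∧ (τ x (q i) : EReal) ≤ β i}

open Classical in
/-- The power sum of the `τ(x,y) ∈ I` over the ordered pairs of distinct points of `C`. -/
def powerSum (C : Finset M) (I : Set ℝ) (k : ℕ) : ℝ :=
  ∑ p ∈ C ×ˢ C with p.1 ≠ p.2 ∧ τ p.1 p.2 ∈ I, τ p.1 p.2 ^ k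

end Codes

/-- The pieces of `[a,b]` cut out by `a = u₁ < ⋯ < u_{ℓ+1} = b`: they are `[u_i, u_{i+1})` for
`i < ℓ`, and `[u_ℓ, b]` for `i = ℓ`. -/
def piece {ℓ : ℕ} (u : Fin (ℓ + 1) → ℝ) (i : Fin ℓ) : Set ℝ :=
  if (i : ℕ) + 1 = ℓ then Set.Icc (u i.castSucc) (u i.succ) else Set.Ico (u i.castSucc) (u i.succ)

/-! ### The constraints of the semidefinite program -/

/-- The Hankel matrix `R_m` with entries `s_{i+j}`. -/
def hankelR (m : ℕ) (s : ℕ → ℝ) : Matrix (Fin m) (Fin m) ℝ :=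
  Matrix.of fun i j => s (i + j)

/-- The matrix with entries `s_{i+j+1} - α s_{i+j}`; for infinite `α` there is no condition,
and the block is zero. -/
def hankelPlus (m : ℕ) (s : ℕ → ℝ) (α : EReal) : Matrix (Fin m) (Fin m) ℝ :=
  if α = ⊥ ∨ α = ⊤ then 0 else Matrix.of fun i j => s (i + j + 1) - α.toReal * s (i + j)

/-- The matrix with entries `β s_{i+j} - s_{i+j+1}`; for infinite `β` there is no condition,
and the block is zero. -/
def hankelMinus (m : ℕ) (s : ℕ → ℝ) (β : EReal) : Matrix (Fin m) (Fin m) ℝ :=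
  if β = ⊥ ∨ β = ⊤ then 0 else Matrix.of fun i j => β.toReal * s (i + j) - s (i + j + 1)

/-- The block diagonal matrix `H_m(s_0, …, s_{2m-1}, [α,β])`. -/
def hankelH (m : ℕ) (s : ℕ → ℝ) (α β : EReal) :
    Matrix (Fin m ⊕ (Fin m ⊕ Fin m)) (Fin m ⊕ (Fin m ⊕ Fin m)) ℝ :=
  Matrix.fromBlocks (hankelR m s) 0 0
    (Matrix.fromBlocks (hankelPlus m s α) 0 0 (hankelMinus m s β))

/-- An additional positive semidefinite constraint on the variables `c` and `x_i^{(k)}`: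
a linear matrix inequality with real symmetric matrices, in which the `x_i^{(k)}` with `k < deg`
may occur. -/
structure AdConstraint (ℓ : ℕ) where
  size : ℕ
  deg : ℕ
  const : Matrix (Fin size) (Fin size) ℝ
  coeffC : Matrix (Fin size) (Fin size) ℝ
  coeffX : Fin ℓ → Fin deg → Matrix (Fin size) (Fin size) ℝ
  const_symm : const.IsSymm
  coeffC_symm : coeffC.IsSymm
  coeffX_symm : ∀ i k, (coeffX i k).IsSymm

/-- The constraint holds at `c`, `x i k = x_i^{(k)}`. -/
def AdConstraint.Holds {ℓ : ℕ} (A : AdConstraint ℓ) (c : ℝ) (x : Fin ℓ → ℕ → ℝ) : Prop :=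
  (A.const + c • A.coeffC + ∑ i, ∑ k : Fin A.deg, x i k • A.coeffX i k).PosSemidef

/-- Every `S`-code in `P` satisfies all the additional constraints, with `c` the size of the code
and `x_i^{(k)}` its power sums over the `i`-th piece of `[a,b]`. -/
def AdValid {M : Type*} (τ : M → M → ℝ) (P : Set M) (S : Set ℝ) {ℓ : ℕ} (u : Fin (ℓ + 1) → ℝ)
    (Ad : Set (AdConstraint ℓ)) : Prop :=
  ∀ C : Finset M, (C : Set M) ⊆ P → IsCode τ S C →
    ∀ A ∈ Ad, A.Holds C.card (fun i k => powerSum τ C (piece u i) k)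

/-- The matrix `G_k`, written in the variables: with `Φ = ∑ d, p_d t^d` its entries are
`Φ(τ(q_i,q_j))`, in the last row and column `∑ d, p_d y_i^{(d)}`, and in the corner
`c + ∑ d, p_d ∑ i, x_i^{(d)}`. -/
def gramG {M : Type*} (τ : M → M → ℝ) {r ℓ : ℕ} (q : Fin r → M) (Φ : ℝ[X]) (c : ℝ)
    (x : Fin ℓ → ℕ → ℝ) (y : Fin r → ℕ → ℝ) : Matrix (Fin r ⊕ Unit) (Fin r ⊕ Unit) ℝ :=
  Matrix.fromBlocks
    (Matrix.of fun i j => Φ.eval (τ (q i) (q j)))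
    (Matrix.of fun i _ => ∑ d ∈ Finset.range (Φ.natDegree + 1), Φ.coeff d * y i d)
    (Matrix.of fun _ j => ∑ d ∈ Finset.range (Φ.natDegree + 1), Φ.coeff d * y j d)
    (Matrix.of fun _ _ =>
      c + ∑ d ∈ Finset.range (Φ.natDegree + 1), Φ.coeff d * ∑ i, x i d)

/-- Feasibility of `c`, `x i k = x_i^{(k)}`, `y i k = y_i^{(k)}` for the semidefinite program of
order `m`. The variables `x_i^{(k)}` with `k ≥ 2m` that occur in no additional constraint and the
`y_i^{(k)}` with `k ≥ 2m` occur in no constraint at all, so they are idle. -/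
structure Feasible {M : Type*} (τ : M → M → ℝ) {r ℓ : ℕ} (q : Fin r → M) (α β : Fin r → EReal)
    (D : ℕ∞) (Φ : ℕ → ℝ[X]) (u : Fin (ℓ + 1) → ℝ) (Ad : Set (AdConstraint ℓ)) (m : ℕ)
    (c : ℝ) (x : Fin ℓ → ℕ → ℝ) (y : Fin r → ℕ → ℝ) : Prop where
  hankel_x : ∀ i : Fin ℓ,
    (hankelH m (x i) (u i.castSucc : EReal) (u i.succ : EReal)).PosSemidef
  additional : ∀ A ∈ Ad, A.Holds c x
  gram : ∀ k : ℕ, k < 2 * m → (k : ℕ∞) ≤ D → (gramG τ q (Φ k) c x y).PosSemidef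
  y_zero : ∀ i : Fin r, y i 0 = c
  hankel_y : ∀ i : Fin r, (hankelH m (y i) (α i) (β i)).PosSemidef

/-- `c*(m)`: the optimal value of the semidefinite program of order `m`. -/
def cStar {M : Type*} (τ : M → M → ℝ) {r ℓ : ℕ} (q : Fin r → M) (α β : Fin r → EReal)
    (D : ℕ∞) (Φ : ℕ → ℝ[X]) (u : Fin (ℓ + 1) → ℝ) (Ad : Set (AdConstraint ℓ)) (m : ℕ) : EReal :=
  sSup {v : EReal | ∃ (c : ℝ) (x : Fin ℓ → ℕ → ℝ) (y : Fin r → ℕ → ℝ),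
    Feasible τ q α β D Φ u Ad m c x y ∧ v = (c : EReal)}

/-- The bound `SDPA`: the infimum of `c*(m)` over all `m ≥ 1`. -/
def sdpa {M : Type*} (τ : M → M → ℝ) {r ℓ : ℕ} (q : Fin r → M) (α β : Fin r → EReal)
    (D : ℕ∞) (Φ : ℕ → ℝ[X]) (u : Fin (ℓ + 1) → ℝ) (Ad : Set (AdConstraint ℓ)) : EReal :=
  ⨅ (m : ℕ) (_ : 1 ≤ m), cStar τ q α β D Φ u Ad m

end SDPCodes

end

/-!
Let `C` be an `S`-code in `P`. The power sums of `τ(x,y)` over the pairs of distinct points of `C`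
with `τ(x,y)` in the `i`-th piece, and those of `τ(z, q i)` over `z ∈ C`, are moments of point
measures supported on `[u_i, u_{i+1}]` and on `[α i, β i]`, so their Hankel matrices are positive
semidefinite. With these values `G_k` arises from the positive definite kernel `Φ_k(τ(x,y))` by
summing it over the blocks `{q₁}, …, {q_r}, C`. Hence `|C|` is feasible for every program.
-/

namespace SDPCodes

section PosSemidef

open Matrix

variable {m n R : Type*} [Ring R] [PartialOrder R] [StarRing R]

open scoped ComplexOrder in
/- `Matrix.posSemidef_gram` is restricted to a finite index type. -/
theorem posSemidef_gram {E 𝕜 : Type*} [RCLike 𝕜] [SeminormedAddCommGroup E]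
    [InnerProductSpace 𝕜 E] (v : n → E) : (gram 𝕜 v).PosSemidef := by
  refine ⟨isHermitian_gram 𝕜 v, fun x => ?_⟩
  have hnorm : (x.sum fun i xi => x.sum fun j xj => star xi * gram 𝕜 v i j * xj)
      = inner 𝕜 (x.sum fun i xi => xi • v i) (x.sum fun i xi => xi • v i) := by
    simp only [Finsupp.sum, sum_inner, inner_sum, inner_smul_left, inner_smul_right, gram_apply,
      Finset.mul_sum]
    rw [Finset.sum_comm]
    refine Finset.sum_congr rfl fun i _ => Finset.sum_congr rfl fun j _ => ?_
    rw [RCLike.star_def]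
    ring
  rw [hnorm, ← inner_self_ofReal_norm]
  positivity

theorem posSemidef_fromBlocks_diagonal [AddLeftMono R] {A : Matrix m m R} {B : Matrix n n R}
    (hA : A.PosSemidef) (hB : B.PosSemidef) : (fromBlocks A 0 0 B).PosSemidef := by
  refine ⟨hA.1.fromBlocks conjTranspose_zero hB.1, fun x => ?_⟩
  obtain ⟨⟨y, z⟩, rfl⟩ := Finsupp.sumFinsuppEquivProdFinsupp.symm.surjective x
  simpa [Finsupp.sum_sumElim, Function.comp_def] using add_nonneg (hA.2 y) (hB.2 z)

theorem sum_sum_single_index {A B : Type*} [AddCommMonoid A] [AddCommMonoid B] (S : m → Finset n)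
    (x : m →₀ A) {h : n → A → B} (h_zero : ∀ a, h a 0 = 0)
    (h_add : ∀ a s t, h a (s + t) = h a s + h a t) :
    (x.sum fun i xi => ∑ a ∈ S i, Finsupp.single a xi).sum h
      = x.sum fun i xi => ∑ a ∈ S i, h a xi := by
  simp [Finsupp.sum_sum_index, ← Finsupp.sum_finsetSum_index, h_zero, h_add]

theorem posSemidef_sum_sum {K : Matrix n n R} (hK : K.PosSemidef) (S : m → Finset n) :
    (of fun i j => ∑ a ∈ S i, ∑ b ∈ S j, K a b).PosSemidef := by
  refine ⟨?_, fun x => ?_⟩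
  · ext i j
    simp only [conjTranspose_apply, of_apply, star_sum, hK.1.apply]
    exact Finset.sum_comm
  · have hinner (a : n) (c : R) : (x.sum fun i xi => ∑ a ∈ S i, Finsupp.single a xi).sum
        (fun b y => star c * K a b * y) = x.sum fun j xj => ∑ b ∈ S j, star c * K a b * xj :=
      sum_sum_single_index S x (by simp) (by simp [mul_add])
    have hnonneg := hK.2 (x.sum fun i xi => ∑ a ∈ S i, Finsupp.single a xi)
    simp only [hinner] at hnonneg
    rw [sum_sum_single_index S x (by simp)
      (by simp [add_mul, Finset.sum_add_distrib, Finsupp.sum_add])] at hnonneg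
    simpa only [of_apply, Finset.mul_sum, Finset.sum_mul, Finsupp.sum_finsetSum_comm]
      using hnonneg

end PosSemidef

section Moments

variable {ι : Type*} (T : Finset ι) (w t : ι → ℝ)

/-- The `k`-th moment of the point measure on `ℝ` with mass `w p` at `t p` for each `p ∈ T`. -/
def moment (k : ℕ) : ℝ := ∑ p ∈ T, w p * t p ^ k

theorem sum_coeff_mul_moment (Φ : ℝ[X]) :
    ∑ d ∈ Finset.range (Φ.natDegree + 1), Φ.coeff d * moment T w t d
      = ∑ p ∈ T, w p * Φ.eval (t p) := by
  simp only [moment, eval_eq_sum_range, Finset.mul_sum, mul_left_comm]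
  exact Finset.sum_comm

open Classical in
theorem sum_moment_filter {κ : Type*} [Fintype κ] {I : κ → Set ℝ}
    (hI : ∀ p ∈ T, ∃! i, t p ∈ I i) (k : ℕ) :
    ∑ i, moment {p ∈ T | t p ∈ I i} w t k = moment T w t k := by
  simp only [moment, Finset.sum_filter]
  rw [Finset.sum_comm]
  refine Finset.sum_congr rfl fun p hp => ?_
  obtain ⟨i, hi, huniq⟩ := hI p hp
  rw [Fintype.sum_eq_single i fun j hj => if_neg fun h => hj (huniq j h), if_pos hi]

variable {T w t} (m : ℕ) {α β : EReal}

theorem posSemidef_hankelR_moment (hw : ∀ p ∈ T, 0 ≤ w p) :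
    (hankelR m (moment T w t)).PosSemidef := by
  have hsum : hankelR m (moment T w t) = ∑ p ∈ T, w p •
      Matrix.vecMulVec (fun i : Fin m => t p ^ (i : ℕ)) (star fun i : Fin m => t p ^ (i : ℕ)) := by
    ext i j
    simp [hankelR, moment, Matrix.sum_apply, Matrix.vecMulVec_apply, pow_add]
  rw [hsum]
  exact Matrix.posSemidef_sum T fun p hp =>
    (Matrix.posSemidef_vecMulVec_self_star _).smul (hw p hp)

theorem hankelPlus_moment_coe (a : ℝ) :
    hankelPlus m (moment T w t) a = hankelR m (moment T (fun p => w p * (t p - a)) t) := by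
  ext i j
  simp only [hankelPlus, hankelR, moment, EReal.coe_ne_bot, EReal.coe_ne_top, or_self, if_false,
    EReal.toReal_coe, Matrix.of_apply, Finset.mul_sum, ← Finset.sum_sub_distrib]
  exact Finset.sum_congr rfl fun p _ => by ring

theorem hankelMinus_moment_coe (b : ℝ) :
    hankelMinus m (moment T w t) b = hankelR m (moment T (fun p => w p * (b - t p)) t) := by
  ext i j
  simp only [hankelMinus, hankelR, moment, EReal.coe_ne_bot, EReal.coe_ne_top, or_self, if_false,
    EReal.toReal_coe, Matrix.of_apply, Finset.mul_sum, ← Finset.sum_sub_distrib]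
  exact Finset.sum_congr rfl fun p _ => by ring

theorem posSemidef_hankelPlus_moment (hw : ∀ p ∈ T, 0 ≤ w p) (hα : ∀ p ∈ T, α ≤ t p) :
    (hankelPlus m (moment T w t) α).PosSemidef := by
  induction α with
  | bot => simpa [hankelPlus] using Matrix.PosSemidef.zero
  | top => simpa [hankelPlus] using Matrix.PosSemidef.zero
  | coe a =>
    rw [hankelPlus_moment_coe]
    exact posSemidef_hankelR_moment m fun p hp =>
      mul_nonneg (hw p hp) (sub_nonneg.2 (EReal.coe_le_coe_iff.1 (hα p hp)))

theorem posSemidef_hankelMinus_moment (hw : ∀ p ∈ T, 0 ≤ w p) (hβ : ∀ p ∈ T, t p ≤ β) :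
    (hankelMinus m (moment T w t) β).PosSemidef := by
  induction β with
  | bot => simpa [hankelMinus] using Matrix.PosSemidef.zero
  | top => simpa [hankelMinus] using Matrix.PosSemidef.zero
  | coe b =>
    rw [hankelMinus_moment_coe]
    exact posSemidef_hankelR_moment m fun p hp =>
      mul_nonneg (hw p hp) (sub_nonneg.2 (EReal.coe_le_coe_iff.1 (hβ p hp)))

theorem posSemidef_hankelH_moment (hw : ∀ p ∈ T, 0 ≤ w p) (hα : ∀ p ∈ T, α ≤ t p)
    (hβ : ∀ p ∈ T, t p ≤ β) : (hankelH m (moment T w t) α β).PosSemidef :=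
  posSemidef_fromBlocks_diagonal (posSemidef_hankelR_moment m hw)
    (posSemidef_fromBlocks_diagonal (posSemidef_hankelPlus_moment m hw hα)
      (posSemidef_hankelMinus_moment m hw hβ))

end Moments

section Pieces

variable {ℓ : ℕ} {u : Fin (ℓ + 1) → ℝ} {t : ℝ}

theorem piece_subset_Icc (u : Fin (ℓ + 1) → ℝ) (i : Fin ℓ) :
    piece u i ⊆ Set.Icc (u i.castSucc) (u i.succ) := by
  unfold piece
  split_ifs
  exacts [subset_rfl, Set.Ico_subset_Icc_self]

theorem Ico_subset_piece (u : Fin (ℓ + 1) → ℝ) (i : Fin ℓ) :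
    Set.Ico (u i.castSucc) (u i.succ) ⊆ piece u i := by
  unfold piece
  split_ifs
  exacts [Set.Ico_subset_Icc_self, subset_rfl]

theorem exists_mem_Ico_of_lt (h0 : u 0 ≤ t) (j : Fin (ℓ + 1)) (hj : t < u j) :
    ∃ i : Fin ℓ, t ∈ Set.Ico (u i.castSucc) (u i.succ) := by
  induction j using Fin.induction with
  | zero => exact absurd hj h0.not_gt
  | succ i ih =>
    rcases le_or_gt (u i.castSucc) t with hi | hi
    exacts [⟨i, hi, hj⟩, ih hi]

theorem exists_mem_piece (hℓ : 1 ≤ ℓ) (hu : Monotone u)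
    (ht : t ∈ Set.Icc (u 0) (u (Fin.last ℓ))) : ∃ i, t ∈ piece u i := by
  obtain ⟨n, rfl⟩ : ∃ n, ℓ = n + 1 := ⟨ℓ - 1, by omega⟩
  rcases ht.2.lt_or_eq with hlt | rfl
  · obtain ⟨i, hi⟩ := exists_mem_Ico_of_lt ht.1 _ hlt
    exact ⟨i, Ico_subset_piece u i hi⟩
  · refine ⟨Fin.last n, ?_⟩
    simpa [piece] using hu (Fin.le_last _)

theorem lt_of_mem_piece_of_lt (hu : Monotone u) {j k : Fin ℓ} (hjk : j < k)
    (hj : t ∈ piece u j) : t < u k.castSucc := by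
  have hj_ne : (j : ℕ) + 1 ≠ ℓ := ((Nat.succ_le_of_lt hjk).trans_lt k.isLt).ne
  rw [piece, if_neg hj_ne] at hj
  exact hj.2.trans_le (hu (Fin.succ_le_castSucc_iff.2 hjk))

theorem existsUnique_mem_piece (hℓ : 1 ≤ ℓ) (hu : Monotone u)
    (ht : t ∈ Set.Icc (u 0) (u (Fin.last ℓ))) : ∃! i, t ∈ piece u i := by
  obtain ⟨i, hi⟩ := exists_mem_piece hℓ hu ht
  refine ⟨i, hi, fun j hj => le_antisymm (le_of_not_gt fun h => ?_) (le_of_not_gt fun h => ?_)⟩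
  · exact (lt_of_mem_piece_of_lt hu h hi).not_ge (piece_subset_Icc u j hj).1
  · exact (lt_of_mem_piece_of_lt hu h hj).not_ge (piece_subset_Icc u i hi).1

end Pieces

section Kernel

/-- The kernel `Φ(τ(x,y))`, as a matrix indexed by the points. Since `Matrix.PosSemidef` tests
finitely supported vectors, it says for this matrix that the kernel is positive definite. -/
def evalKernel {M : Type*} (τ : M → M → ℝ) (Φ : ℝ[X]) : Matrix M M ℝ :=
  Matrix.of fun x y => Φ.eval (τ x y)

theorem IsZonalOf.posSemidef_evalKernel {M : Type*} [MetricSpace M] [MeasurableSpace M]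
    {μ : Measure M} {τ : M → M → ℝ} {V : Submodule ℂ C(M, ℂ)} {Φ : ℝ[X]}
    (h : IsZonalOf μ τ V Φ) (hdiag : ∀ x, 0 < Φ.eval (τ x x)) :
    (evalKernel τ Φ).PosSemidef := by
  obtain ⟨n, φ, κ, -, -, hexp⟩ := h
  let v (x : M) : EuclideanSpace ℂ (Fin n) := WithLp.toLp 2 fun i => φ i x
  have hgram : evalKernel τ Φ = κ • Matrix.gram ℝ v := by
    ext x y
    have hre := congrArg Complex.re (hexp x y)
    rw [Complex.ofReal_re, Complex.re_ofReal_mul] at hre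
    simp [evalKernel, hre, v, PiLp.inner_apply, mul_comm]
  rcases isEmpty_or_nonempty M with _ | ⟨⟨x⟩⟩
  · rw [Subsingleton.elim (evalKernel τ Φ) 0]
    exact .zero
  · have hx : Φ.eval (τ x x) = κ * ‖v x‖ ^ 2 := by
      rw [← real_inner_self_eq_norm_sq]
      exact congrFun₂ hgram x x
    rw [hgram]
    exact (posSemidef_gram v).smul (pos_of_mul_pos_left (hx ▸ hdiag x) (sq_nonneg _)).le

section Family

variable {M : Type*} [MetricSpace M] [CompactSpace M] [MeasurableSpace M] [BorelSpace M]
  {G : Type*} [Group G] [MulAction G M] {μ : Measure M} [IsFiniteMeasure μ]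
  {F : ℝ → ℝ} {D : ℕ∞} {Φ : ℕ → ℝ[X]} {k : ℕ}

theorem IsZonalFamily.eval_dist_self (h : IsZonalFamily G μ F D Φ) (hk : (k : ℕ∞) ≤ D) (x : M) :
    (Φ k).eval (F (dist x x)) = 1 := by
  obtain ⟨V, -, -, -, hV⟩ := h
  rw [dist_self]
  exact (hV k hk).2.2

theorem IsZonalFamily.posSemidef_evalKernel (h : IsZonalFamily G μ F D Φ) (hk : (k : ℕ∞) ≤ D) :
    (evalKernel (fun x y : M => F (dist x y)) (Φ k)).PosSemidef := by
  have hone := h.eval_dist_self hk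
  obtain ⟨V, -, -, -, hV⟩ := h
  exact (hV k hk).1.posSemidef_evalKernel fun x => (hone x).symm ▸ one_pos

end Family

end Kernel

section Codes

variable {M : Type*} {τ : M → M → ℝ} {r ℓ : ℕ} {u : Fin (ℓ + 1) → ℝ} {C : Finset M}

open Classical in
theorem powerSum_eq_moment (τ : M → M → ℝ) (C : Finset M) (I : Set ℝ) :
    powerSum τ C I = moment {p ∈ C.offDiag | τ p.1 p.2 ∈ I} 1 fun p => τ p.1 p.2 := by
  ext k
  simp only [powerSum, moment, Pi.one_apply, one_mul]
  exact Finset.sum_congr (by ext; simp; tauto) fun _ _ => rfl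

theorem sum_powerSum_piece (hℓ : 1 ≤ ℓ) (hu : Monotone u)
    (hC : IsCode τ (Set.Icc (u 0) (u (Fin.last ℓ))) C) (k : ℕ) :
    ∑ i, powerSum τ C (piece u i) k = moment C.offDiag 1 (fun p => τ p.1 p.2) k := by
  simp only [powerSum_eq_moment]
  refine sum_moment_filter _ _ _ (fun p hp => existsUnique_mem_piece hℓ hu ?_) k
  obtain ⟨hx, hy, hxy⟩ := Finset.mem_offDiag.1 hp
  exact hC _ hx _ hy hxy

theorem card_add_sum_powerSum (hℓ : 1 ≤ ℓ) (hu : Monotone u)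
    (hC : IsCode τ (Set.Icc (u 0) (u (Fin.last ℓ))) C) {Φ : ℝ[X]}
    (hΦ : ∀ x ∈ C, Φ.eval (τ x x) = 1) :
    (C.card : ℝ) + ∑ d ∈ Finset.range (Φ.natDegree + 1),
        Φ.coeff d * ∑ i, powerSum τ C (piece u i) d
      = ∑ x ∈ C, ∑ y ∈ C, Φ.eval (τ x y) := by
  classical
  have hdiag : ∑ p ∈ C.diag, Φ.eval (τ p.1 p.2) = C.card := by
    rw [Finset.sum_diag, Finset.sum_congr rfl hΦ, Finset.sum_const, nsmul_one]
  simp only [sum_powerSum_piece hℓ hu hC, sum_coeff_mul_moment, Pi.one_apply, one_mul]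
  rw [← hdiag, ← Finset.sum_union C.disjoint_diag_offDiag, C.diag_union_offDiag,
    Finset.sum_product]

theorem posSemidef_gramG (q : Fin r → M) {Φ : ℝ[X]} (hΦ : (evalKernel τ Φ).PosSemidef)
    {c : ℝ} {x : Fin ℓ → ℕ → ℝ}
    (hc : c + ∑ d ∈ Finset.range (Φ.natDegree + 1), Φ.coeff d * ∑ i, x i d
      = ∑ a ∈ C, ∑ b ∈ C, Φ.eval (τ a b)) :
    (gramG τ q Φ c x fun i => moment C 1 (τ · (q i))).PosSemidef := by
  have hsymm (a b : M) : Φ.eval (τ a b) = Φ.eval (τ b a) := hΦ.1.apply b a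
  convert posSemidef_sum_sum hΦ (Sum.elim (fun i => {q i}) fun _ => C)
  ext (i | i) (j | j)
  · simp [gramG, evalKernel]
  · simp [gramG, evalKernel, sum_coeff_mul_moment, hsymm (q i)]
  · simp [gramG, evalKernel, sum_coeff_mul_moment]
  · simpa [gramG, evalKernel] using hc

theorem feasible_of_isCode {D : ℕ∞} {Φ : ℕ → ℝ[X]}
    (hpos : ∀ k : ℕ, (k : ℕ∞) ≤ D → (evalKernel τ (Φ k)).PosSemidef)
    (hone : ∀ k : ℕ, (k : ℕ∞) ≤ D → ∀ x, (Φ k).eval (τ x x) = 1)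
    (hℓ : 1 ≤ ℓ) (hu : Monotone u) {q : Fin r → M} {α β : Fin r → EReal}
    {Ad : Set (AdConstraint ℓ)} (hCP : (C : Set M) ⊆ region τ q α β)
    (hC : IsCode τ (Set.Icc (u 0) (u (Fin.last ℓ))) C)
    (hAd : ∀ A ∈ Ad, A.Holds C.card fun i k => powerSum τ C (piece u i) k) (m : ℕ) :
    Feasible τ q α β D Φ u Ad m C.card (fun i => powerSum τ C (piece u i))
      (fun i => moment C 1 (τ · (q i))) where
  hankel_x i := by
    classical
    rw [powerSum_eq_moment]
    have hmem {p : M × M} (hp : p ∈ ({p ∈ C.offDiag | τ p.1 p.2 ∈ piece u i} : Finset _)) :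
        τ p.1 p.2 ∈ Set.Icc (u i.castSucc) (u i.succ) :=
      piece_subset_Icc u i (Finset.mem_filter.1 hp).2
    exact posSemidef_hankelH_moment m (fun _ _ => zero_le_one)
      (fun p hp => EReal.coe_le_coe_iff.2 (hmem hp).1)
      (fun p hp => EReal.coe_le_coe_iff.2 (hmem hp).2)
  additional := hAd
  gram k _ hk := posSemidef_gramG q (hpos k hk)
    (card_add_sum_powerSum hℓ hu hC fun x _ => hone k hk x)
  y_zero i := by simp [moment]
  hankel_y i := posSemidef_hankelH_moment m (fun _ _ => zero_le_one)
    (fun _ hz => (hCP hz i).1) (fun _ hz => (hCP hz i).2)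

end Codes

end SDPCodes

theorem theorem7p2_general {M : Type*} (τ : M → M → ℝ) (D : ℕ∞) (Φ : ℕ → ℝ[X])
    (hpos : ∀ k : ℕ, (k : ℕ∞) ≤ D → (SDPCodes.evalKernel τ (Φ k)).PosSemidef)
    (hone : ∀ k : ℕ, (k : ℕ∞) ≤ D → ∀ x, (Φ k).eval (τ x x) = 1)
    {ℓ : ℕ} (hℓ : 1 ≤ ℓ) (u : Fin (ℓ + 1) → ℝ) (hu : Monotone u)
    (S : Set ℝ) (hS : S ⊆ Set.Icc (u 0) (u (Fin.last ℓ)))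
    {r : ℕ} (q : Fin r → M) (α β : Fin r → EReal)
    (P : Set M) (hP : P ⊆ SDPCodes.region τ q α β)
    (Ad : Set (SDPCodes.AdConstraint ℓ)) (hAd : SDPCodes.AdValid τ P S u Ad) :
    SDPCodes.maxCodeSize τ P S ≤ SDPCodes.sdpa τ q α β D Φ u Ad ∧
      ∀ m : ℕ, 1 ≤ m →
        SDPCodes.sdpa τ q α β D Φ u Ad ≤ SDPCodes.cStar τ q α β D Φ u Ad m := by
  refine ⟨le_iInf₂ fun m _ => iSup₂_le fun C ⟨hCP, hC⟩ => le_sSup ?_, fun m hm => iInf₂_le m hm⟩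
  exact ⟨C.card, _, _, SDPCodes.feasible_of_isCode hpos hone hℓ hu (hCP.trans hP)
    (fun x hx y hy hxy => hS (hC x hx y hy hxy)) (hAd C hCP hC) m, rfl⟩

theorem theorem7p2 {M : Type*} [MetricSpace M] [CompactSpace M] [MeasurableSpace M] [BorelSpace M]
    {G : Type*} [Group G] [MulAction G M] [IsIsometricSMul G M]
    (hG : SDPCodes.IsTwoPointHomogeneous G M)
    (μ : MeasureTheory.Measure M) [MeasureTheory.IsProbabilityMeasure μ]
    [MeasureTheory.SMulInvariantMeasure G M μ]
    (F : ℝ → ℝ) (τ : M → M → ℝ) (hτ : ∀ x y, τ x y = F (dist x y))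
    (D : ℕ∞) (Φ : ℕ → Polynomial ℝ) (hΦ : SDPCodes.IsZonalFamily G μ F D Φ)
    (a b : ℝ) (S : Set ℝ) (hS : S = SDPCodes.valueSet τ a b)
    {ℓ : ℕ} (hℓ : 1 ≤ ℓ) (u : Fin (ℓ + 1) → ℝ) (hu : StrictMono u)
    (hua : u 0 = a) (hub : u (Fin.last ℓ) = b)
    {r : ℕ} (q : Fin r → M) (α β : Fin r → EReal) (hαβ : ∀ i, α i ≤ β i)
    (P : Set M) (hP : P ⊆ SDPCodes.region τ q α β)
    (Ad : Set (SDPCodes.AdConstraint ℓ)) (hAd : SDPCodes.AdValid τ P S u Ad) :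
    SDPCodes.maxCodeSize τ P S ≤ SDPCodes.sdpa τ q α β D Φ u Ad ∧
      ∀ m : ℕ, 1 ≤ m →
        SDPCodes.sdpa τ q α β D Φ u Ad ≤ SDPCodes.cStar τ q α β D Φ u Ad m := by
  subst hS hua hub
  obtain rfl : τ = fun x y => F (dist x y) := funext₂ hτ
  exact theorem7p2_general _ D Φ (fun _ => hΦ.posSemidef_evalKernel) (fun _ => hΦ.eval_dist_self)
    hℓ u hu.monotone _ Set.inter_subset_right q α β P hP Ad hAd
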